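/- Let $m\ge 1$ be an integer. An $m$-ballot path of size $n$ is a lattice path from $(0,0)$ to $(nm,n)$ with steps $(1,0)$ and $(0,1)$ that never goes below the line $y=x/m$; it is primitive if $n\ge 1$ and it touches this line only at its two end points. A rotation of a path exchanges a horizontal step with the primitive path that starts right after it (if there is one), i.e. replaces $a\,0\,P\,b$ by $a\,P\,0\,b$, where paths are written as words with $1=(0,1)$ and $0=(1,0)$. The $m$-Tamari order on $m$-ballot paths of size $n$ is the reflexive and transitive closure of the rotation ($D\le D'$ if $D'$ is obtained from $D$ by a sequence of rotations). Let $$\Phi^{(m)}(x,y)=\sum_{n\ge 0}\ \sum_{[D,D']} x^{c(D)}\,y^{n}\in\mathbb Z[x][[y]],$$ where the inner sum is over all intervals $[D,D']$, $D\le D'$, of $m$-ballot paths of size $n$, and $c(D)$ is the number of contacts of the lower path $D$ with the line $y=x/m$ after the starting point. For $f,g\in\mathbb Z[x][[y]]$ put $$f\succ g:=fg,\qquad f\prec_\delta g:=f\,\Delta(g),\qquad \Delta(g):=\frac{x\,g(x,y)-g(1,y)}{x-1},$$ and let $\mathcal B^{(m)}$ be the $(m+1)$-linear operator $$\mathcal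 B^{(m)}(f,g_1,\dots,g_m):=f\succ xy\prec_\delta\bigl(g_1\prec_\delta(g_2\prec_\delta(\cdots\prec_\delta(g_{m-1}\prec_\delta g_m)\cdots))\bigr).$$ Then $$\Phi^{(m)}=\mathcal B^{(m)}\bigl(\Phi^{(m)},\dots,\Phi^{(m)}\bigr)+1 .$$ -/

import Mathlib

namespace MTamari

open Polynomial

/-! ### Ballot paths and the `m`-Tamari order

A lattice path is a binary word: `true` is a vertical step `(0,1)`, `false` a horizontal step
`(1,0)`. -/

/-- `w` is a path from `(0,0)` to `(n*m, n)` which never goes below the line `y = x / m`. -/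
def IsBallotWord (m n : ℕ) (w : List Bool) : Prop :=
  w.count true = n ∧ w.count false = m * n ∧
    ∀ k, (w.take k).count false ≤ m * (w.take k).count true

/-- After `k` steps, the path `w` is on the line `y = x / m`. -/
def TouchesAt (m : ℕ) (w : List Bool) (k : ℕ) : Prop :=
  (w.take k).count false = m * (w.take k).count true

instance (m : ℕ) (w : List Bool) : DecidablePred (TouchesAt m w) :=
  fun _ => inferInstanceAs (Decidable (_ = _))

/-- A nonempty `m`-ballot path which touches the line `y = x / m` only at its two end points. -/
def IsPrimitive (m : ℕ) (w : List Bool) : Prop :=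
  w ≠ [] ∧ (∃ n, IsBallotWord m n w) ∧ ∀ k, 0 < k → k < w.length → ¬ TouchesAt m w k

/-- The `m`-ballot paths of size `n`. -/
def BallotPath (m n : ℕ) : Type := {w : List Bool // IsBallotWord m n w}

/-- The number of contacts of the path `w` with the line `y = x / m` after the starting point. -/
def contacts (m : ℕ) (w : List Bool) : ℕ :=
  ((Finset.Icc 1 w.length).filter (TouchesAt m w)).card

/-- `D'` is obtained from `D` by one rotation: a horizontal step of `D` is exchanged with the
primitive path that starts right after it. -/
def Rotation {m n : ℕ} (D D' : BallotPath m n) : Prop :=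
  ∃ a P b : List Bool, IsPrimitive m P ∧
    D.1 = a ++ [false] ++ P ++ b ∧ D'.1 = a ++ P ++ [false] ++ b

theorem Rotation.lt {m n : ℕ} {D D' : BallotPath m n} (h : Rotation D D') : D.1 < D'.1 := by
  obtain ⟨a, P, b, ⟨hne, ⟨k, -, -, hP⟩, -⟩, h1, h2⟩ := h
  rw [h1, h2]
  cases P with
  | nil => exact absurd rfl hne
  | cons c P =>
    cases c with
    | false => simpa using hP 1
    | true =>
      simp only [List.append_assoc]
      refine List.append_left_lt ?_
      exact List.Lex.rel (by decide)

/-- The `m`-Tamari order: the reflexive and transitive closure of the rotation. -/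
instance instPartialOrder (m n : ℕ) : PartialOrder (BallotPath m n) where
  le := Relation.ReflTransGen Rotation
  le_refl _ := Relation.ReflTransGen.refl
  le_trans _ _ _ h h' := h.trans h'
  le_antisymm D D' h h' := by
    have key : ∀ {D D' : BallotPath m n}, Relation.ReflTransGen Rotation D D' → D.1 ≤ D'.1 := by
      intro D D' h
      induction h with
      | refl => exact le_refl _
      | tail _ h ih => exact ih.trans h.lt.le
    exact Subtype.ext (le_antisymm (key h) (key h'))

instance instFinite (m n : ℕ) : Finite (BallotPath m n) := by
  refine Set.Finite.to_subtype ((List.finite_length_eq Bool (n + m * n)).subset ?_)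
  rintro w ⟨h1, h2, -⟩
  have := List.count_false_add_count_true w
  simp only [Set.mem_ofPred_eq]
  omega

/-- There are finitely many intervals `[D, D']` in the `m`-Tamari poset of size `n`
(an interval is given by its end points `D ≤ D'`). -/
noncomputable instance instFintypeInterval (m n : ℕ) :
    Fintype (NonemptyInterval (BallotPath m n)) :=
  haveI : Finite (NonemptyInterval (BallotPath m n)) :=
    Finite.of_injective _ NonemptyInterval.toProd_injective
  Fintype.ofFinite _

/-! ### Generating functions

Series in `y` whose coefficients are polynomials in `x`. -/

/-- The ring `ℤ[x][[y]]`. -/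
abbrev Series : Type := PowerSeries ℤ[X]

/-- The variable `x`. -/
noncomputable def x : Series := PowerSeries.C X

/-- The variable `y`. -/
noncomputable def y : Series := PowerSeries.X

/-- The generating function of the intervals `[D, D']` of the `m`-Tamari posets: `y` counts the
size and `x` the contacts of the lower path `D`. -/
noncomputable def Phi (m : ℕ) : Series :=
  PowerSeries.mk fun n => ∑ I : NonemptyInterval (BallotPath m n), X ^ contacts m I.fst.1

/-- The specialization `g(1, y)`, as a series that is constant in `x`. -/
noncomputable def evalOne (g : Series) : Series :=
  PowerSeries.mk fun n => C ((PowerSeries.coeff n g).eval 1)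

/-- The operator `Δ(g) = (x g(x, y) - g(1, y)) / (x - 1)`: the division by the monic polynomial
`x - 1` is done on each coefficient, and is exact. -/
noncomputable def Delta (g : Series) : Series :=
  PowerSeries.mk fun n => PowerSeries.coeff n (x * g - evalOne g) /ₘ (X - C 1)

/-- The division in the definition of `Δ` is exact. -/
theorem sub_one_mul_Delta (g : Series) : (x - 1) * Delta g = x * g - evalOne g := by
  have hx : (x - 1 : Series) = PowerSeries.C (X - C 1) := by simp [x]
  ext1 n
  rw [hx, PowerSeries.coeff_C_mul, Delta, PowerSeries.coeff_mk, mul_divByMonic_eq_iff_isRoot]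
  simp [x, evalOne, IsRoot]

theorem Delta_unique {g h : Series} (H : (x - 1) * h = x * g - evalOne g) : h = Delta g := by
  have hx : (x - 1 : Series) ≠ 0 := by
    have : (x - 1 : Series) = PowerSeries.C (X - C 1) := by simp [x]
    rw [this, Ne, map_eq_zero_iff _ (PowerSeries.C_injective)]
    exact X_sub_C_ne_zero 1
  exact mul_left_cancel₀ hx (H.trans (sub_one_mul_Delta g).symm)

theorem Delta_add (g h : Series) : Delta (g + h) = Delta g + Delta h := by
  refine (Delta_unique ?_).symm
  have : evalOne (g + h) = evalOne g + evalOne h := by ext1 n; simp [evalOne]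
  rw [mul_add, sub_one_mul_Delta, sub_one_mul_Delta, this]
  ring

theorem Delta_smul (c : ℤ) (g : Series) : Delta (c • g) = c • Delta g := by
  refine (Delta_unique ?_).symm
  have : evalOne (c • g) = c • evalOne g := by
    ext1 n
    simp only [evalOne, PowerSeries.coeff_mk, map_zsmul, ← coe_evalRingHom]
  rw [mul_smul_comm, sub_one_mul_Delta, this, mul_smul_comm, smul_sub]

/-- The product `f ≻ g = f g`. -/
noncomputable def prodSucc (f g : Series) : Series := f * g

/-- The product `f ≺_δ g = f Δ(g)`. -/
noncomputable def prodPrec (f g : Series) : Series := f * Delta g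

/-- `g₁ ≺_δ (g₂ ≺_δ (⋯ ≺_δ (g_{m-1} ≺_δ g_m)⋯))`, for `m ≥ 1` (the value for `m = 0` is
irrelevant). -/
noncomputable def nestedPrec : (m : ℕ) → (Fin m → Series) → Series
  | 0, _ => 0
  | 1, g => g 0
  | m + 2, g => prodPrec (g 0) (nestedPrec (m + 1) (Fin.tail g))

theorem nestedPrec_update_add : ∀ (m : ℕ) (g : Fin m → Series) (i : Fin m) (a b : Series),
    nestedPrec m (Function.update g i (a + b)) =
      nestedPrec m (Function.update g i a) + nestedPrec m (Function.update g i b)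
  | 0, _, i, _, _ => i.elim0
  | 1, g, i, a, b => by
    obtain rfl : i = 0 := Subsingleton.elim _ _
    simp [nestedPrec]
  | m + 2, g, i, a, b => by
    refine Fin.cases ?_ (fun i => ?_) i
    · simp [nestedPrec, prodPrec, Fin.tail_update_zero, add_mul]
    · have h0 : ∀ c, Function.update g i.succ c 0 = g 0 := fun c =>
        Function.update_of_ne (Fin.succ_ne_zero i).symm _ _
      simp only [nestedPrec, prodPrec, Fin.tail_update_succ, h0,
        nestedPrec_update_add (m + 1), Delta_add, mul_add]

theorem nestedPrec_update_smul : ∀ (m : ℕ) (g : Fin m → Series) (i : Fin m) (c : ℤ) (a : Series),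
    nestedPrec m (Function.update g i (c • a)) = c • nestedPrec m (Function.update g i a)
  | 0, _, i, _, _ => i.elim0
  | 1, g, i, c, a => by
    obtain rfl : i = 0 := Subsingleton.elim _ _
    simp [nestedPrec]
  | m + 2, g, i, c, a => by
    refine Fin.cases ?_ (fun i => ?_) i
    · simp only [nestedPrec, prodPrec, Fin.tail_update_zero, Function.update_self, smul_mul_assoc]
    · have h0 : ∀ d, Function.update g i.succ d 0 = g 0 := fun d =>
        Function.update_of_ne (Fin.succ_ne_zero i).symm _ _
      simp only [nestedPrec, prodPrec, Fin.tail_update_succ, h0,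
        nestedPrec_update_smul (m + 1), Delta_smul, mul_smul_comm]

/-- The `(m+1)`-linear operator
`B(f, g₁, …, g_m) = f ≻ x y ≺_δ (g₁ ≺_δ (⋯ ≺_δ (g_{m-1} ≺_δ g_m)⋯))`,
where `f` is the entry of index `0` and `g_i` the entry of index `i`. -/
noncomputable def operatorB (m : ℕ) : MultilinearMap ℤ (fun _ : Fin (m + 1) => Series) Series where
  toFun F := prodSucc (F 0) (prodPrec (x * y) (nestedPrec m (Fin.tail F)))
  map_update_add' {inst} F i a b := by
    obtain rfl := Subsingleton.elim inst (instDecidableEqFin _)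
    refine Fin.cases ?_ (fun i => ?_) i
    · simp [prodSucc, Fin.tail_update_zero, add_mul]
    · have h0 : ∀ c, Function.update F i.succ c 0 = F 0 := fun c =>
        Function.update_of_ne (Fin.succ_ne_zero i).symm _ _
      simp only [prodSucc, prodPrec, Fin.tail_update_succ, h0, nestedPrec_update_add, Delta_add,
        mul_add]
  map_update_smul' {inst} F i c a := by
    obtain rfl := Subsingleton.elim inst (instDecidableEqFin _)
    refine Fin.cases ?_ (fun i => ?_) i
    · simp only [prodSucc, Fin.tail_update_zero, Function.update_self, smul_mul_assoc]
    · have h0 : ∀ d, Function.update F i.succ d 0 = F 0 := fun d =>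
        Function.update_of_ne (Fin.succ_ne_zero i).symm _ _
      simp only [prodSucc, prodPrec, Fin.tail_update_succ, h0, nestedPrec_update_smul, Delta_smul,
        mul_smul_comm]

end MTamari

/-! Ballot paths are generalized to words descending by `k`: they end at height `-k` and never go
lower (a vertical step counts `m`, a horizontal one `-1`). Intervals of such words have a series
`F_k = intervalSeries m k`, in which `x` counts the visits of the lower word to its final level
before its end, that is, its nonempty suffixes of height 0. For `k = 0` these match the contacts, so
`Φ = F_0`.

Removing the initial vertical step gives `F_0 = x y F_m + 1`. The heart is `F_{k+1} = F_0 Δ(F_k)`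
(`intervalSeries_succ`). Cut the upper word at its first passage to `-(k+1)`, as `S 0 Q`. Following
the marked `0` down the order, it can only move left, jumping over primitive paths, so the lower
word is `A 0 B C` with `B`, `C` ballot, `A B ≤ S` and `C ≤ Q` (`WordLE.exists_split`); the converse
is `wordLE_of_split`. The interval thus amounts to `[C, Q]`, `[A B, S]` and a cut of `A B` at a
visit to its final level. The cuts of a word of weight `x^c` leave `B` with `0, …, c` contacts, once
each, and `Δ` replaces `x^c` by `1 + x + ⋯ + x^c`.

Iterating from `F_0 = Φ` identifies the nested product of `m` copies of `Φ` with `F_{m-1}`, which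
yields the equation. -/

namespace MTamari

open Polynomial

/-! ### Words, heights and the rotation order on words -/

section Words

variable (m : ℕ)

/-- The height reached by a word: a vertical step counts `m`, a horizontal step `-1`. -/
def height (w : List Bool) : ℤ := m * w.count true - w.count false

@[simp] theorem height_nil : height m [] = 0 := by simp [height]

@[simp] theorem height_true (w : List Bool) : height m (true :: w) = m + height m w := by
  simp [height]; ring

@[simp] theorem height_false (w : List Bool) : height m (false :: w) = height m w - 1 := by
  simp [height]; ring

@[simp] theorem height_append (u v : List Bool) :
    height m (u ++ v) = height m u + height m v := by
  simp [height]; ring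

/-- All prefixes of `w` have height at least `-k`, and `w` has height `-k`. -/
def Descends (k : ℕ) (w : List Bool) : Prop :=
  height m w = -k ∧ ∀ u v, w = u ++ v → -(k : ℤ) ≤ height m u

/-- The rotation, on arbitrary words. -/
def WordRotation (w w' : List Bool) : Prop :=
  ∃ a P b : List Bool, IsPrimitive m P ∧ w = a ++ [false] ++ P ++ b ∧ w' = a ++ P ++ [false] ++ b

/-- The reflexive and transitive closure of the rotation of words. -/
abbrev WordLE : List Bool → List Bool → Prop := Relation.ReflTransGen (WordRotation m)

/-- The number of nonempty suffixes of height `0`. -/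
def suffixContacts : List Bool → ℕ
  | [] => 0
  | a :: w => suffixContacts w + if height m (a :: w) = 0 then 1 else 0

variable {m}

/-! ### Ballot and primitive paths in terms of heights -/

theorem isBallotWord_iff {n : ℕ} {w : List Bool} :
    IsBallotWord m n w ↔ Descends m 0 w ∧ w.count true = n := by
  constructor
  · rintro ⟨h1, h2, h3⟩
    refine ⟨⟨by simp [height, h1, h2], ?_⟩, h1⟩
    rintro u v rfl
    have := h3 u.length
    simp only [List.take_left'] at this
    have : (u.count false : ℤ) ≤ m * u.count true := by exact_mod_cast this
    simp only [height]; push_cast; linarith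
  · rintro ⟨⟨h1, h2⟩, rfl⟩
    refine ⟨rfl, ?_, fun k => ?_⟩
    · simp only [height] at h1
      push_cast at h1
      have : (w.count false : ℤ) = m * w.count true := by linarith
      exact_mod_cast this
    · have := h2 (w.take k) (w.drop k) (List.take_append_drop k w).symm
      simp only [height] at this
      push_cast at this
      have : ((w.take k).count false : ℤ) ≤ m * (w.take k).count true := by linarith
      exact_mod_cast this

theorem touchesAt_iff {w : List Bool} {k : ℕ} : TouchesAt m w k ↔ height m (w.take k) = 0 := by
  rw [TouchesAt, height, sub_eq_zero, eq_comm]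
  norm_cast

theorem isPrimitive_iff {P : List Bool} :
    IsPrimitive m P ↔ P ≠ [] ∧ height m P = 0 ∧
      ∀ u v, P = u ++ v → u ≠ [] → v ≠ [] → 0 < height m u := by
  constructor
  · rintro ⟨h1, ⟨n, h2⟩, h3⟩
    obtain ⟨⟨h4, h5⟩, -⟩ := isBallotWord_iff.1 h2
    refine ⟨h1, by simpa using h4, ?_⟩
    rintro u v rfl hu hv
    have h6 := h3 u.length (List.length_pos_of_ne_nil hu)
      (by have := List.length_pos_of_ne_nil hv; simp; omega)
    rw [touchesAt_iff, List.take_left'  rfl] at h6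
    have := h5 u v rfl
    simp only [Nat.cast_zero, neg_zero] at this
    omega
  · rintro ⟨h1, h2, h3⟩
    refine ⟨h1, ⟨P.count true, isBallotWord_iff.2 ⟨⟨by simpa using h2, fun u v h => ?_⟩, rfl⟩⟩, ?_⟩
    · rcases eq_or_ne u [] with rfl | hu
      · simp
      rcases eq_or_ne v [] with rfl | hv
      · rw [List.append_nil] at h
        subst h
        simp [h2]
      · simpa using (h3 u v h hu hv).le
    · intro k hk hk' h
      rw [touchesAt_iff] at h
      refine (h3 (P.take k) (P.drop k) (List.take_append_drop k P).symm ?_ ?_).ne' h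
      · simp [h1]; omega
      · simp; omega

theorem IsPrimitive.height_eq {P : List Bool} (h : IsPrimitive m P) : height m P = 0 :=
  (isPrimitive_iff.1 h).2.1

theorem IsPrimitive.descends {P : List Bool} (h : IsPrimitive m P) : Descends m 0 P := by
  obtain ⟨-, ⟨n, h⟩, -⟩ := h
  exact (isBallotWord_iff.1 h).1

theorem descends_nil : Descends m 0 [] := by
  refine ⟨by simp, fun u v h => ?_⟩
  obtain ⟨rfl, rfl⟩ := List.append_eq_nil_iff.1 h.symm
  simp

theorem Descends.append {k l : ℕ} {u v : List Bool} (hu : Descends m k u) (hv : Descends m l v) :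
    Descends m (k + l) (u ++ v) := by
  refine ⟨by rw [height_append, hu.1, hv.1]; push_cast; ring, fun a b h => ?_⟩
  rcases List.append_eq_append_iff.1 h with ⟨c, rfl, hc⟩ | ⟨c, rfl, hc⟩
  · rw [height_append, hu.1]
    have := hv.2 _ _ hc
    push_cast; linarith
  · have := hu.2 _ _ rfl
    push_cast; linarith

theorem descends_singleton_false : Descends m 1 [false] := by
  refine ⟨by simp, fun u v h => ?_⟩
  rcases List.singleton_eq_append_iff.1 h with ⟨rfl, -⟩ | ⟨rfl, -⟩ <;> simp

theorem descends_true_cons {w : List Bool} : Descends m 0 (true :: w) ↔ Descends m m w := by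
  constructor
  · rintro ⟨h1, h2⟩
    refine ⟨by simp at h1; linarith, fun u v h => ?_⟩
    have := h2 (true :: u) v (by simp [h])
    simp at this; linarith
  · rintro ⟨h1, h2⟩
    refine ⟨by simp [h1], fun u v h => ?_⟩
    cases u with
    | nil => simp
    | cons a u =>
      obtain ⟨rfl, hw⟩ := List.cons.inj h
      have := h2 _ _ hw
      simp; linarith

theorem Descends.exists_true_cons {w : List Bool} (h : Descends m 0 w) (hw : w ≠ []) :
    ∃ v, w = true :: v ∧ Descends m m v := by
  match w, hw with
  | true :: v, _ => exact ⟨v, rfl, descends_true_cons.1 h⟩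
  | false :: v, _ => simpa using h.2 [false] v rfl

/-- A rotation neither creates nor destroys the property of descending by `k`. -/
theorem descends_rotate_iff {k : ℕ} {a P b : List Bool} (hP : IsPrimitive m P) :
    Descends m k (a ++ [false] ++ P ++ b) ↔ Descends m k (a ++ P ++ [false] ++ b) := by
  have h0 := hP.height_eq
  have h1 := hP.descends.2
  constructor
  · rintro ⟨hw, h⟩
    refine ⟨by simp [h0] at hw ⊢; linarith, fun u v huv => ?_⟩
    rcases List.append_eq_append_iff.1 huv with ⟨c, rfl, rfl⟩ | ⟨c, hu, -⟩
    · have := h (a ++ [false] ++ P ++ c) v (by simp)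
      simp [h0] at this ⊢; linarith
    rcases List.append_eq_append_iff.1 hu with ⟨d, rfl, hd⟩ | ⟨d, hu', -⟩
    · rcases List.singleton_eq_append_iff.1 hd with ⟨rfl, rfl⟩ | ⟨rfl, rfl⟩
      · have := h a ([false] ++ P ++ b) (by simp)
        simp [h0] at this ⊢; linarith
      · have := h (a ++ [false]) (P ++ b) (by simp)
        simp [h0] at this ⊢; linarith
    rcases List.append_eq_append_iff.1 hu' with ⟨e, rfl, rfl⟩ | ⟨e, rfl, rfl⟩
    · have := h a ([false] ++ (e ++ d) ++ b) (by simp)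
      have := h1 e d rfl
      simp at *; linarith
    · exact h u (e ++ [false] ++ P ++ b) (by simp)
  · rintro ⟨hw, h⟩
    refine ⟨by simp [h0] at hw ⊢; linarith, fun u v huv => ?_⟩
    rcases List.append_eq_append_iff.1 huv with ⟨c, rfl, rfl⟩ | ⟨c, hu, -⟩
    · have := h (a ++ P ++ [false] ++ c) v (by simp)
      simp [h0] at this ⊢; linarith
    have h2 := h (a ++ P ++ [false]) b rfl
    rcases List.append_eq_append_iff.1 hu with ⟨e, rfl, rfl⟩ | ⟨d, hu', -⟩
    · have := h1 e c rfl
      simp at *; linarith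
    rcases List.append_eq_append_iff.1 hu' with ⟨e, rfl, hd⟩ | ⟨e, rfl, rfl⟩
    · rcases List.singleton_eq_append_iff.1 hd with ⟨rfl, rfl⟩ | ⟨rfl, rfl⟩
      · simpa using h a (P ++ [false] ++ b) (by simp)
      · simp [h0] at h2 ⊢; linarith
    · exact h u (e ++ P ++ [false] ++ b) (by simp)

/-! ### Invariants of the order and its compatibility with concatenation -/

theorem WordRotation.descends_iff {k : ℕ} {w w' : List Bool} (h : WordRotation m w w') :
    Descends m k w ↔ Descends m k w' := by
  obtain ⟨a, P, b, hP, rfl, rfl⟩ := h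
  exact descends_rotate_iff hP

theorem WordLE.descends_iff {k : ℕ} {w w' : List Bool} (h : WordLE m w w') :
    Descends m k w ↔ Descends m k w' := by
  induction h with
  | refl => rfl
  | tail _ h ih => exact ih.trans h.descends_iff

theorem WordLE.perm {w w' : List Bool} (h : WordLE m w w') : w.Perm w' := by
  induction h with
  | refl => rfl
  | tail _ h ih =>
    refine ih.trans ?_
    obtain ⟨a, P, b, -, rfl, rfl⟩ := h
    simp only [List.append_assoc]
    refine List.Perm.append_left _ ?_
    rw [← List.append_assoc, ← List.append_assoc P]
    exact List.Perm.append_right _ List.perm_append_comm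

theorem WordLE.append_left {w w' : List Bool} (h : WordLE m w w') (u : List Bool) :
    WordLE m (u ++ w) (u ++ w') := by
  refine Relation.ReflTransGen.lift (u ++ ·) ?_ _ _ h
  rintro _ _ ⟨a, P, b, hP, rfl, rfl⟩
  exact ⟨u ++ a, P, b, hP, by simp, by simp⟩

theorem WordLE.append_right {w w' : List Bool} (h : WordLE m w w') (v : List Bool) :
    WordLE m (w ++ v) (w' ++ v) := by
  refine Relation.ReflTransGen.lift (· ++ v) ?_ _ _ h
  rintro _ _ ⟨a, P, b, hP, rfl, rfl⟩
  exact ⟨a, P, b ++ v, hP, by simp, by simp⟩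

/-- The part of a word changed by a rotation starts with a horizontal step, so an initial vertical
step is never involved. -/
theorem wordLE_true_cons {P Q : List Bool} : WordLE m (true :: P) (true :: Q) ↔ WordLE m P Q := by
  refine ⟨fun h => ?_, fun h => h.append_left [true]⟩
  suffices H : ∀ W, WordLE m (true :: P) W → ∃ V, W = true :: V ∧ WordLE m P V by
    obtain ⟨V, hV, h⟩ := H _ h
    rwa [(List.cons.inj hV).2]
  intro W h
  induction h with
  | refl => exact ⟨P, rfl, .refl⟩
  | tail _ h ih =>
    obtain ⟨V, rfl, hV⟩ := ih
    obtain ⟨a, R, b, hR, h1, rfl⟩ := h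
    cases a with
    | nil => simp at h1
    | cons t a =>
      simp only [List.cons_append, List.cons.injEq] at h1
      obtain ⟨rfl, rfl⟩ := h1
      exact ⟨a ++ R ++ [false] ++ b, by simp, hV.tail ⟨a, R, b, hR, rfl, rfl⟩⟩

theorem Descends.of_append {k : ℕ} {u v : List Bool} (h : Descends m k (u ++ v))
    (hv : height m v = 0) : Descends m k u ∧ Descends m 0 v := by
  have hu : height m u = -k := by simpa [hv] using h.1
  refine ⟨⟨hu, fun a b hab => h.2 a (b ++ v) (by simp [hab])⟩, by simpa using hv,
    fun a b hab => ?_⟩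
  have := h.2 (u ++ a) b (by simp [hab])
  simp [hu] at this ⊢; linarith

/-- First passage decomposition. -/
theorem exists_first_passage (k : ℕ) (w : List Bool) (h : height m w ≤ -(k + 1 : ℤ)) :
    ∃ S Q, w = S ++ false :: Q ∧ Descends m k S := by
  induction w generalizing k with
  | nil => simp at h; omega
  | cons a w ih =>
    cases a with
    | true =>
      -- The vertical step has raised the path by `m`, so the rest must descend by `m` more.
      obtain ⟨S, Q, rfl, hS⟩ := ih (k + m) (by simp at h; push_cast; linarith)
      refine ⟨true :: S, Q, rfl, by have := hS.1; simp at *; linarith, fun u v huv => ?_⟩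
      cases u with
      | nil => simp
      | cons t u =>
        obtain ⟨rfl, hu⟩ := List.cons.inj huv
        have := hS.2 _ _ hu
        simp at *; linarith
    | false =>
      cases k with
      | zero => exact ⟨[], w, rfl, descends_nil⟩
      | succ k =>
        obtain ⟨S, Q, rfl, hS⟩ := ih k (by simp at h; linarith)
        refine ⟨false :: S, Q, rfl, ?_⟩
        rw [Nat.add_comm]
        exact descends_singleton_false.append hS

theorem Descends.append_false_append {k : ℕ} {A B : List Bool} (hA : Descends m k A)
    (hB : Descends m 0 B) : Descends m (k + 1) (A ++ false :: B) := by
  simpa using hA.append (descends_singleton_false.append hB)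

theorem Descends.exists_eq_append {k : ℕ} {w : List Bool} (h : Descends m (k + 1) w) :
    ∃ S Q, w = S ++ false :: Q ∧ Descends m k S ∧ Descends m 0 Q := by
  obtain ⟨S, Q, rfl, hS⟩ := exists_first_passage k w (by rw [h.1]; push_cast; rfl)
  refine ⟨S, Q, rfl, hS, ?_, fun u v huv => ?_⟩
  · have := h.1
    simp [hS.1] at this ⊢; linarith
  · have := h.2 (S ++ false :: u) v (by simp [huv])
    simp [hS.1] at this ⊢; linarith

/-- The first passage below `-k` is unique: if `S'` were longer than `S`, it would contain the step
that goes below `-k`. -/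
theorem Descends.append_false_inj {k : ℕ} {S S' Q Q' : List Bool} (hS : Descends m k S)
    (hS' : Descends m k S') (h : S ++ false :: Q = S' ++ false :: Q') : S = S' ∧ Q = Q' := by
  suffices H : ∀ {S S' Q Q' : List Bool}, Descends m k S → Descends m k S' →
      S ++ false :: Q = S' ++ false :: Q' → ∀ c, S' = S ++ c → c = [] by
    rcases List.append_eq_append_iff.1 h with ⟨c, hc, -⟩ | ⟨c, hc, -⟩
    · obtain rfl := H hS hS' h c hc
      rw [List.append_nil] at hc
      subst hc
      simpa using h
    · obtain rfl := H hS' hS h.symm c hc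
      rw [List.append_nil] at hc
      subst hc
      simpa using h
  rintro S S' Q Q' hS hS' h c rfl
  cases c with
  | nil => rfl
  | cons t c =>
    simp only [List.append_assoc, List.append_cancel_left_eq, List.cons_append,
      List.cons.injEq] at h
    obtain ⟨rfl, -⟩ := h
    have := hS'.2 (S ++ [false]) c (by simp)
    simp [hS.1] at this

theorem isPrimitive_of_descends (hm : 1 ≤ m) {S : List Bool} (hS : Descends m (m - 1) S) :
    IsPrimitive m (true :: (S ++ [false])) := by
  refine isPrimitive_iff.2 ⟨by simp, by simp [hS.1, hm]; ring, fun u v h hu hv => ?_⟩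
  cases u with
  | nil => exact absurd rfl hu
  | cons t u =>
    obtain ⟨rfl, h'⟩ := List.cons.inj h
    obtain ⟨v', s, rfl⟩ := List.eq_nil_or_concat v |>.resolve_left hv
    rw [List.append_eq, List.concat_eq_append, ← List.append_assoc] at h'
    have := hS.2 _ _ (List.append_inj' h' rfl).1
    simp [hm] at *; linarith

/-- A horizontal step can be moved to the right of a whole ballot path. -/
theorem Descends.wordLE_false_cons (hm : 1 ≤ m) {B : List Bool} (hB : Descends m 0 B) :
    WordLE m (false :: B) (B ++ [false]) := by
  induction hn : B.length using Nat.strong_induction_on generalizing B with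
  | _ n ih =>
    rcases eq_or_ne B [] with rfl | hne
    · exact .refl
    obtain ⟨v, rfl, hv⟩ := hB.exists_true_cons hne
    obtain ⟨S, Q, rfl, hS, hQ⟩ := Descends.exists_eq_append (m := m) (k := m - 1) (w := v)
      (by rwa [show m - 1 + 1 = m by omega])
    -- One rotation passes the first primitive factor; the remaining ballot path `Q` is left to the
    -- induction.
    refine Relation.ReflTransGen.head ⟨[], _, Q, isPrimitive_of_descends hm hS, by simp, rfl⟩ ?_
    have := (ih Q.length (by subst hn; simp; omega) hQ rfl).append_left (true :: (S ++ [false]))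
    simpa using this

/-! ### Splitting an interval along the first passage of its upper word -/

theorem append_split {a P b U V : List Bool} (h : a ++ P ++ false :: b = U ++ V) :
    (∃ e, U = a ++ P ++ false :: e ∧ b = e ++ V) ∨
    (∃ g, a = U ++ g ∧ V = g ++ P ++ false :: b) ∨
    (∃ p q, P = p ++ q ∧ p ≠ [] ∧ U = a ++ p ∧ V = q ++ false :: b) := by
  rcases List.append_eq_append_iff.1 h with ⟨c, rfl, hc⟩ | ⟨c, hc, rfl⟩
  · cases c with
    | nil =>
      rcases eq_or_ne P [] with rfl | hP
      · exact .inr (.inl ⟨[], by simp, by simpa using hc.symm⟩)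
      · exact .inr (.inr ⟨P, [], by simp, hP, by simp, by simpa using hc.symm⟩)
    | cons t c =>
      obtain ⟨rfl, rfl⟩ := List.cons.inj hc
      exact .inl ⟨c, rfl, rfl⟩
  · rcases List.append_eq_append_iff.1 hc with ⟨d, rfl, rfl⟩ | ⟨d, rfl, rfl⟩
    · rcases eq_or_ne d [] with rfl | hd
      · exact .inr (.inl ⟨[], by simp, by simp⟩)
      · exact .inr (.inr ⟨d, c, rfl, hd, rfl, rfl⟩)
    · exact .inr (.inl ⟨d, rfl, by simp⟩)

/-- A rotation cannot straddle the beginning of a ballot path. -/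
theorem rotation_split {a P b U V : List Bool} (hP : IsPrimitive m P) (hV : Descends m 0 V)
    (h : a ++ P ++ false :: b = U ++ V) :
    (∃ e, U = a ++ P ++ false :: e ∧ b = e ++ V) ∨
    (∃ g, a = U ++ g ∧ V = g ++ P ++ false :: b) := by
  rcases append_split h with h | h | ⟨p, q, rfl, -, -, rfl⟩
  · exact .inl h
  · exact .inr h
  -- A suffix `q` of `P` has height at most 0, so the prefix `q 0` of `V` would be negative.
  · have h1 := hV.2 (q ++ [false]) b (by simp)
    have h2 := hP.descends.2 p q rfl
    have h3 := hP.height_eq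
    simp at h1 h2 h3
    linarith

/-- Undoing a rotation either acts inside one of `A'`, `B'`, `C'`, or moves the marked `0` left over
a primitive path, which then passes from the end of `A'` to the front of `B`. -/
theorem WordRotation.exists_split {k : ℕ} {w A' B' C' : List Bool}
    (h : WordRotation m w (A' ++ false :: (B' ++ C'))) (hA' : Descends m k A')
    (hB' : Descends m 0 B') (hC' : Descends m 0 C') :
    ∃ A B C, w = A ++ false :: (B ++ C) ∧ Descends m k A ∧ Descends m 0 B ∧ Descends m 0 C ∧
      WordLE m (A ++ B) (A' ++ B') ∧ WordLE m C C' := by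
  obtain ⟨a, P, b, hP, rfl, h⟩ := h
  replace h : a ++ P ++ false :: b = (A' ++ false :: B') ++ C' := by simpa using h.symm
  rcases rotation_split hP hC' h with ⟨e, h₁, rfl⟩ | ⟨g, rfl, rfl⟩
  · replace h₁ : a ++ P ++ false :: e = (A' ++ [false]) ++ B' := by simpa using h₁.symm
    rcases rotation_split hP hB' h₁ with ⟨f, h₂, rfl⟩ | ⟨g, rfl, rfl⟩
    · rcases List.eq_nil_or_concat f with rfl | ⟨f, t, rfl⟩
      -- Here the exchanged step is the marked `0` itself.
      · obtain rfl : A' = a ++ P := by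
          refine (List.append_inj' (t₁ := [false]) (t₂ := [false]) ?_ rfl).1
          simpa using h₂
        refine ⟨a, P ++ B', C', by simp, (hA'.of_append hP.height_eq).1,
          hP.descends.append hB', hC', ?_, .refl⟩
        rw [List.append_assoc]
      · have h' : A' ++ [false] = (a ++ P ++ false :: f) ++ [t] := by simpa using h₂
        obtain ⟨rfl, ht⟩ := List.append_inj' h' rfl
        obtain rfl : false = t := by simpa using ht
        have h1 : WordRotation m (a ++ [false] ++ P ++ f) (a ++ P ++ false :: f) :=
          ⟨a, P, f, hP, rfl, by simp⟩
        refine ⟨a ++ [false] ++ P ++ f, B', C', by simp, h1.descends_iff.2 hA', hB', hC', ?_, .refl⟩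
        exact WordLE.append_right (.single h1) _
    · have h1 : WordRotation m (g ++ [false] ++ P ++ e) (g ++ P ++ false :: e) :=
        ⟨g, P, e, hP, rfl, by simp⟩
      exact ⟨A', g ++ [false] ++ P ++ e, C', by simp, hA', h1.descends_iff.2 hB', hC',
        WordLE.append_left (.single h1) _, .refl⟩
  · have h1 : WordRotation m (g ++ [false] ++ P ++ b) (g ++ P ++ false :: b) :=
      ⟨g, P, b, hP, rfl, by simp⟩
    exact ⟨A', B', g ++ [false] ++ P ++ b, by simp, hA', hB', h1.descends_iff.2 hC', .refl,
      .single h1⟩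

theorem WordLE.exists_split {k : ℕ} {w S Q : List Bool} (h : WordLE m w (S ++ false :: Q))
    (hS : Descends m k S) (hQ : Descends m 0 Q) :
    ∃ A B C, w = A ++ false :: (B ++ C) ∧ Descends m k A ∧ Descends m 0 B ∧ Descends m 0 C ∧
      WordLE m (A ++ B) S ∧ WordLE m C Q := by
  induction h using Relation.ReflTransGen.head_induction_on with
  | refl => exact ⟨S, [], Q, by simp, hS, descends_nil, hQ, by rw [List.append_nil], .refl⟩
  | head h _ ih =>
    obtain ⟨A', B', C', rfl, hA', hB', hC', h1, h2⟩ := ih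
    obtain ⟨A, B, C, rfl, hA, hB, hC, h3, h4⟩ := h.exists_split hA' hB' hC'
    exact ⟨A, B, C, rfl, hA, hB, hC, h3.trans h1, h4.trans h2⟩

/-- The chain is `A 0 B C ≤ A 0 B Q ≤ A B 0 Q ≤ S 0 Q`; its middle step moves `0` across the ballot
path `B`. -/
theorem wordLE_of_split (hm : 1 ≤ m) {A B C S Q : List Bool} (hB : Descends m 0 B)
    (h : WordLE m (A ++ B) S) (h' : WordLE m C Q) :
    WordLE m (A ++ false :: (B ++ C)) (S ++ false :: Q) := by
  have h1 : WordLE m (A ++ false :: (B ++ C)) (A ++ false :: (B ++ Q)) := by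
    simpa using h'.append_left (A ++ false :: B)
  have h2 : WordLE m (A ++ false :: (B ++ Q)) (A ++ B ++ false :: Q) := by
    simpa using ((hB.wordLE_false_cons hm).append_left A).append_right Q
  exact (h1.trans h2).trans (h.append_right (false :: Q))

/-! ### Contacts -/

theorem suffixContacts_append {u v : List Bool} (hv : height m v = 0) :
    suffixContacts m (u ++ v) = suffixContacts m u + suffixContacts m v := by
  induction u with
  | nil => simp [suffixContacts]
  | cons a u ih =>
    have : height m (a :: (u ++ v)) = height m (a :: u) := by
      rw [← List.cons_append, height_append, hv, add_zero]
    simp only [List.cons_append, suffixContacts, ih, this]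
    ring

theorem suffixContacts_append_of_neg {u v : List Bool}
    (h : ∀ a b, u = a ++ b → b ≠ [] → height m (b ++ v) ≠ 0) :
    suffixContacts m (u ++ v) = suffixContacts m v := by
  induction u with
  | nil => rfl
  | cons a u ih =>
    have h1 := h [] (a :: u) rfl (by simp)
    simp only [List.cons_append] at h1
    rw [List.cons_append, suffixContacts, if_neg h1, add_zero,
      ih fun c d hcd hd => h (a :: c) d (by simp [hcd]) hd]

/-- Suffixes of `A` have height at most 0, so every suffix that contains the marked `0` is negative.
-/
theorem suffixContacts_split {k : ℕ} {A B : List Bool} (hA : Descends m k A)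
    (hB : Descends m 0 B) : suffixContacts m (A ++ false :: B) = suffixContacts m B := by
  have hB0 : height m B = 0 := by simpa using hB.1
  rw [suffixContacts_append_of_neg, suffixContacts, if_neg (by simp [hB0]), add_zero]
  intro a b hab _
  have h1 := hA.1
  have h2 := hA.2 a b hab
  simp [hab, hB0] at *
  omega

theorem suffixContacts_true_cons {w : List Bool} (h : Descends m m w) :
    suffixContacts m (true :: w) = suffixContacts m w + 1 := by
  rw [suffixContacts, if_pos (by simp [h.1])]

theorem suffixContacts_eq_card (w : List Bool) :
    suffixContacts m w =
      ((Finset.range w.length).filter fun i => height m (w.drop i) = 0).card := by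
  induction w with
  | nil => simp [suffixContacts]
  | cons a w ih =>
    rw [suffixContacts, ih, List.length_cons, Finset.card_filter, Finset.card_filter,
      Finset.sum_range_succ']
    simp

theorem contacts_eq_suffixContacts {w : List Bool} (hw : height m w = 0) :
    contacts m w = suffixContacts m w := by
  rw [suffixContacts_eq_card, contacts]
  have key : ∀ i, height m (w.drop i) = 0 ↔ height m (w.take i) = 0 := fun i => by
    have := congrArg (height m) (List.take_append_drop i w)
    rw [height_append, hw] at this
    omega
  simp only [key, Finset.card_filter, touchesAt_iff]
  have hI : Finset.Icc 1 w.length = Finset.Ico 1 (w.length + 1) := by ext; simp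
  rw [hI, Finset.sum_Ico_eq_sum_range, Nat.add_sub_cancel]
  -- Proper prefixes and nonempty prefixes give the same count, since the empty and the full prefix
  -- both have height 0.
  have h1 := Finset.sum_range_succ (fun i => if height m (w.take i) = 0 then 1 else 0) w.length
  rw [Finset.sum_range_succ'] at h1
  simp only [List.take_zero, height_nil, List.take_length, hw, add_left_inj] at h1
  simpa [add_comm 1] using h1

/-- From shortest to longest, the suffixes of height 0, the empty one included, have `0, 1, 2, …`
contacts. -/
theorem sum_drop_suffixContacts (w : List Bool) :
    (∑ i ∈ (Finset.range (w.length + 1)).filter (fun i => height m (w.drop i) = 0),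
      (X : ℤ[X]) ^ suffixContacts m (w.drop i)) =
    ∑ i ∈ Finset.range (suffixContacts m w + 1), X ^ i := by
  induction w with
  | nil => simp [suffixContacts]
  | cons a w ih =>
    rw [Finset.sum_filter] at ih ⊢
    rw [List.length_cons, Finset.sum_range_succ']
    simp only [List.drop_succ_cons, List.drop_zero]
    rw [ih]
    by_cases h : height m (a :: w) = 0
    · rw [if_pos h, suffixContacts, if_pos h, Finset.sum_range_succ _ (suffixContacts m w + 1)]
    · rw [if_neg h, suffixContacts, if_neg h, add_zero, add_zero]

end Words

/-! ### Generating functions of intervals -/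

section Intervals

variable (m : ℕ)

theorem finite_wordIntervals (k n : ℕ) :
    {I : List Bool × List Bool |
      Descends m k I.1 ∧ I.1.count true = n ∧ WordLE m I.1 I.2}.Finite := by
  have hf := List.finite_length_eq Bool (n + (m * n + k))
  refine (hf.prod hf).subset ?_
  rintro ⟨P, Q⟩ ⟨⟨h1, -⟩, h2, h3⟩
  have h4 := List.count_false_add_count_true P
  have h5 := h3.perm.length_eq
  have h6 : (P.count false : ℤ) = m * n + k := by
    simp only [height, h2] at h1; linarith
  have h7 : P.count false = m * n + k := by exact_mod_cast h6
  simp only at h2 h5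
  have : P.length = n + (m * n + k) := by omega
  exact ⟨this, h5.symm.trans this⟩

/-- The intervals of words descending by `k`, with `n` vertical steps. -/
noncomputable def wordIntervals (k n : ℕ) : Finset (List Bool × List Bool) :=
  (finite_wordIntervals m k n).toFinset

variable {m} in
theorem mem_wordIntervals {k n : ℕ} {I : List Bool × List Bool} :
    I ∈ wordIntervals m k n ↔ Descends m k I.1 ∧ I.1.count true = n ∧ WordLE m I.1 I.2 := by
  simp [wordIntervals]

/-- The generating function of the intervals of words descending by `k`. -/
noncomputable def intervalSeries (k : ℕ) : Series :=
  PowerSeries.mk fun n => ∑ I ∈ wordIntervals m k n, X ^ suffixContacts m I.1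

variable {m} in
theorem le_iff_wordLE {n : ℕ} {D D' : BallotPath m n} : D ≤ D' ↔ WordLE m D.1 D'.1 := by
  constructor
  · exact fun h => Relation.ReflTransGen.lift Subtype.val (fun _ _ h => h) _ _ h
  · intro h
    suffices H : ∀ w, WordLE m D.1 w →
        ∀ hw : IsBallotWord m n w, D ≤ (⟨w, hw⟩ : BallotPath m n) from H _ h D'.2
    intro w h
    induction h with
    | refl => exact fun _ => le_refl _
    | @tail b c h h' ih =>
      intro hc
      have hb : IsBallotWord m n b := by
        obtain ⟨h1, h2⟩ := isBallotWord_iff.1 hc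
        exact isBallotWord_iff.2 ⟨h'.descends_iff.2 h1,
          ((WordLE.perm (.single h')).count_eq true).trans h2⟩
      exact Relation.ReflTransGen.tail (ih hb) h'

theorem Phi_eq_intervalSeries : Phi m = intervalSeries m 0 := by
  ext1 n
  rw [Phi, intervalSeries, PowerSeries.coeff_mk, PowerSeries.coeff_mk]
  refine Finset.sum_bij (fun I _ => (I.fst.1, I.snd.1)) ?_ ?_ ?_ ?_
  · intro I _
    obtain ⟨h1, h2⟩ := isBallotWord_iff.1 I.fst.2
    exact mem_wordIntervals.2 ⟨h1, h2, le_iff_wordLE.1 I.fst_le_snd⟩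
  · intro I _ J _ h
    obtain ⟨h1, h2⟩ := Prod.mk.inj h
    exact NonemptyInterval.ext (Prod.ext (Subtype.ext h1) (Subtype.ext h2))
  · rintro ⟨P, Q⟩ h
    obtain ⟨h1, h2, h3⟩ := mem_wordIntervals.1 h
    exact ⟨⟨(⟨P, isBallotWord_iff.2 ⟨h1, h2⟩⟩, ⟨Q, isBallotWord_iff.2
      ⟨h3.descends_iff.1 h1, (h3.perm.count_eq true).symm.trans h2⟩⟩), le_iff_wordLE.2 h3⟩,
      Finset.mem_univ _, rfl⟩
  · intro I _
    rw [contacts_eq_suffixContacts (by simpa using (isBallotWord_iff.1 I.fst.2).1.1)]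

theorem wordIntervals_zero_zero : wordIntervals m 0 0 = {([], [])} := by
  ext ⟨P, Q⟩
  rw [mem_wordIntervals, Finset.mem_singleton]
  constructor
  · rintro ⟨h1, h2, h3⟩
    have hP : P = [] := by
      by_contra hne
      obtain ⟨v, hv, -⟩ := h1.exists_true_cons hne
      simp only at hv h2
      simp [hv] at h2
    have hQ := h3.perm
    simp only [hP, List.nil_perm] at hQ
    rw [hP, hQ]
  · rintro h
    obtain ⟨rfl, rfl⟩ := Prod.mk.inj h
    exact ⟨descends_nil, rfl, .refl⟩

/-! ### Functional equations for the interval series -/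

theorem intervalSeries_zero : intervalSeries m 0 = x * y * intervalSeries m m + 1 := by
  ext1 n
  rw [map_add, mul_assoc, x, y, PowerSeries.coeff_C_mul]
  cases n with
  | zero => simp [intervalSeries, wordIntervals_zero_zero, suffixContacts]
  | succ n =>
    rw [PowerSeries.coeff_succ_X_mul, intervalSeries, intervalSeries, PowerSeries.coeff_mk,
      PowerSeries.coeff_mk, PowerSeries.coeff_one, if_neg n.succ_ne_zero, add_zero, Finset.mul_sum]
    symm
    refine Finset.sum_bij (fun I _ => (true :: I.1, true :: I.2)) ?_ ?_ ?_ ?_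
    · intro I h
      obtain ⟨h1, h2, h3⟩ := mem_wordIntervals.1 h
      exact mem_wordIntervals.2 ⟨descends_true_cons.2 h1, by simp [h2], wordLE_true_cons.2 h3⟩
    · intro I _ J _ h
      simpa [Prod.ext_iff] using h
    · rintro ⟨P, Q⟩ h
      obtain ⟨h1, h2, h3⟩ := mem_wordIntervals.1 h
      simp only at h1 h2 h3
      have hP : P ≠ [] := by rintro rfl; simp at h2
      have hQ : Q ≠ [] := by
        rintro rfl
        exact hP h3.perm.eq_nil
      obtain ⟨P, rfl, hP'⟩ := h1.exists_true_cons hP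
      obtain ⟨Q, rfl, hQ'⟩ := (h3.descends_iff.1 h1).exists_true_cons hQ
      exact ⟨(P, Q), mem_wordIntervals.2 ⟨hP', by simpa using h2, wordLE_true_cons.1 h3⟩, rfl⟩
    · intro I h
      rw [suffixContacts_true_cons (mem_wordIntervals.1 h).1, pow_succ']

/-- Combinatorial meaning of `Δ`: it marks a cut of the lower word at a suffix of height 0 and keeps
only the contacts of that suffix. -/
theorem Delta_intervalSeries (k : ℕ) : Delta (intervalSeries m k) =
    PowerSeries.mk fun n => ∑ I ∈ wordIntervals m k n,
      ∑ i ∈ (Finset.range (I.1.length + 1)).filter (fun i => height m (I.1.drop i) = 0),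
        X ^ suffixContacts m (I.1.drop i) := by
  refine (Delta_unique ?_).symm
  ext1 n
  have hx : (x - 1 : Series) = PowerSeries.C (X - 1) := by simp [x]
  rw [hx, x, PowerSeries.coeff_C_mul, map_sub, PowerSeries.coeff_C_mul, evalOne, intervalSeries]
  simp only [PowerSeries.coeff_mk, sum_drop_suffixContacts]
  rw [Finset.mul_sum]
  simp only [mul_geom_sum]
  simp [pow_succ', eval_finsetSum, Finset.mul_sum]

theorem intervalSeries_succ (hm : 1 ≤ m) (k : ℕ) :
    intervalSeries m (k + 1) = intervalSeries m 0 * Delta (intervalSeries m k) := by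
  ext1 n
  rw [Delta_intervalSeries, PowerSeries.coeff_mul]
  simp only [intervalSeries, PowerSeries.coeff_mk, Finset.sum_mul, Finset.mul_sum, ← pow_add]
  rw [Finset.sum_sigma', Finset.sum_sigma', Finset.sum_sigma']
  symm
  -- An interval `[R, S]` cut at `i` as `R = A B`, together with `[C, Q]`, is sent to `[A 0 B C, S 0
  -- Q]`.
  refine Finset.sum_bij (fun t _ => (t.1.1.2.1.take t.1.2 ++ false ::
    (t.1.1.2.1.drop t.1.2 ++ t.2.1), t.1.1.2.2 ++ false :: t.2.2)) ?_ ?_ ?_ ?_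
  · rintro ⟨⟨⟨⟨n₁, n₂⟩, ⟨R, S⟩⟩, i⟩, ⟨C, Q⟩⟩ h
    simp only [Finset.mem_sigma, Finset.HasAntidiagonal.mem_antidiagonal,
      Finset.mem_filter, Finset.mem_range,
      mem_wordIntervals] at h ⊢
    obtain ⟨⟨⟨hn, hR, hRn, hRS⟩, hi, hB⟩, hC, hCn, hCQ⟩ := h
    rw [← List.take_append_drop i R] at hR hRn hRS
    obtain ⟨hA, hB⟩ := hR.of_append hB
    refine ⟨hA.append_false_append (hB.append hC), ?_, wordLE_of_split hm hB hRS hCQ⟩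
    rw [List.count_append] at hRn
    simp only [List.count_append, List.count_cons]
    simp
    omega
  · rintro ⟨⟨⟨⟨n₁, n₂⟩, ⟨R, S⟩⟩, i⟩, ⟨C, Q⟩⟩ h ⟨⟨⟨⟨n₁', n₂'⟩, ⟨R', S'⟩⟩, i'⟩, ⟨C', Q'⟩⟩ h' heq
    simp only [Finset.mem_sigma, Finset.HasAntidiagonal.mem_antidiagonal,
      Finset.mem_filter, Finset.mem_range,
      mem_wordIntervals] at h h'
    obtain ⟨⟨⟨-, hR, rfl, hRS⟩, hi, hB⟩, hC, rfl, hCQ⟩ := h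
    obtain ⟨⟨⟨-, hR', rfl, hRS'⟩, hi', hB'⟩, hC', rfl, hCQ'⟩ := h'
    obtain ⟨h1, h2⟩ := Prod.mk.inj heq
    obtain ⟨rfl, rfl⟩ := (hRS.descends_iff.1 hR).append_false_inj (hRS'.descends_iff.1 hR') h2
    -- Both `R` and `R'` rearrange the same upper word; equal lengths then separate `B` from `C`.
    have hlen : R.length = R'.length := hRS.perm.length_eq.trans hRS'.perm.length_eq.symm
    have hA := (Descends.of_append (by rwa [List.take_append_drop]) hB).1
    have hA' := (Descends.of_append (by rwa [List.take_append_drop]) hB').1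
    obtain ⟨h3, h4⟩ := hA.append_false_inj hA' h1
    have hii : i = i' := by
      have := congrArg List.length h3
      simp only [List.length_take] at this
      omega
    subst hii
    obtain ⟨h5, rfl⟩ := List.append_inj h4 (by simp [hlen])
    have hRR : R = R' := by rw [← List.take_append_drop i R, h3, h5, List.take_append_drop]
    subst hRR
    rfl
  · rintro ⟨P, W⟩ h
    obtain ⟨hP, hn, hPW⟩ := mem_wordIntervals.1 h
    simp only at hP hn hPW
    obtain ⟨S, Q, rfl, hS, hQ⟩ := (hPW.descends_iff.1 hP).exists_eq_append
    obtain ⟨A, B, C, rfl, hA, hB, hC, hAB, hCQ⟩ := hPW.exists_split hS hQ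
    refine ⟨⟨⟨⟨(C.count true, (A ++ B).count true), (A ++ B, S)⟩, A.length⟩, (C, Q)⟩, ?_, ?_⟩
    · simp only [Finset.mem_sigma, Finset.HasAntidiagonal.mem_antidiagonal,
      Finset.mem_filter, Finset.mem_range,
        mem_wordIntervals]
      refine ⟨⟨⟨?_, hA.append hB, trivial, hAB⟩, by simp, by simpa using hB.1⟩, hC, trivial,
        hCQ⟩
      simp only [List.count_append, List.count_cons] at hn ⊢
      simp at hn
      omega
    · simp
  · rintro ⟨⟨⟨⟨n₁, n₂⟩, ⟨R, S⟩⟩, i⟩, ⟨C, Q⟩⟩ h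
    simp only [Finset.mem_sigma, Finset.HasAntidiagonal.mem_antidiagonal,
      Finset.mem_filter, Finset.mem_range,
      mem_wordIntervals] at h
    obtain ⟨⟨⟨hn, hR, hRn, hRS⟩, hi, hB⟩, hC, hCn, hCQ⟩ := h
    obtain ⟨hA, hB'⟩ := Descends.of_append (by rwa [List.take_append_drop]) hB
    rw [suffixContacts_split hA (hB'.append hC), suffixContacts_append (by simpa using hC.1),
      add_comm]

end Intervals

end MTamari

theorem mainTheorem5 (m : ℕ) (hm : 1 ≤ m) :
    MTamari.Phi m = MTamari.operatorB m (fun _ => MTamari.Phi m) + 1 := by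
  have key : ∀ k, MTamari.nestedPrec (k + 1) (fun _ => MTamari.Phi m) =
      MTamari.intervalSeries m k := by
    intro k
    induction k with
    | zero => exact MTamari.Phi_eq_intervalSeries m
    | succ k ih =>
      rw [MTamari.intervalSeries_succ m hm, ← ih, ← MTamari.Phi_eq_intervalSeries]
      rfl
  -- Writing `m` as a successor lets `key` apply with `k = m - 1`.
  obtain ⟨m, rfl⟩ := Nat.exists_eq_succ_of_ne_zero (by omega : m ≠ 0)
  have h : MTamari.operatorB (m + 1) (fun _ => MTamari.Phi (m + 1)) =
      MTamari.Phi (m + 1) * (MTamari.x * MTamari.y *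
        MTamari.Delta (MTamari.nestedPrec (m + 1) (fun _ => MTamari.Phi (m + 1)))) := rfl
  rw [Nat.succ_eq_add_one, h, key, MTamari.Phi_eq_intervalSeries, mul_left_comm,
    ← MTamari.intervalSeries_succ _ hm]
  exact MTamari.intervalSeries_zero _
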